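/- Let $\theta,\beta>0$. For every integer $N\ge 1$ with $N\ge\theta$ consider the final-time dependent correlated random walk on $\mathbb{Z}$ with the column-stochastic transition matrix $$V^R_N=\begin{bmatrix}(\theta/N)^{\beta} & 1-(\theta/N)^{\beta}\\ 1-(\theta/N)^{\beta} & (\theta/N)^{\beta}\end{bmatrix},$$ that is: the walker starts at the origin with an initial direction that is left or right with probability $1/2$ each; at each of the times $1,\dots,N$ it keeps its previous direction with probability $(\theta/N)^{\beta}$ and reverses it with probability $1-(\theta/N)^{\beta}$, and then moves one unit in the resulting direction (the parameter of all $N$ steps is determined by the final time $N$). Let $p_N(0)$ be the probability that the walker is at the origin at the final time $N$. Then: (i) if $0<\beta<1$, then $\displaystyle\lim_{n\to\infty} n^{(1-\beta)/2}\,p_{2n}(0)=\frac{1}{\sqrt{\pi}}\left(\frac{2}{\theta}\right)^{\beta/2}$; (ii) if $\beta=1$, then $\displaystyle\lim_{n\to\infty} p_{2n}(0)=e^{-\theta}\{I_0(\theta)+I_1(\theta)\}$; (iii) if $\beta>1$, then $\displaystyle\lim_{n\to\infty} n^{\beta-1}\{1-p_{2n}(0)\}=\left(\frac{\theta}{2}\right)^{\beta}$.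 Here $I_k(x)=\sum_{m=0}^{\infty}\frac{(x/2)^{2m+k}}{m!\,(m+k)!}$ is the modified Bessel function of the first kind of order $k$. -/

import Mathlib

open Filter Topology

noncomputable section

/-- The modified Bessel function of the first kind of integer order `k ≥ 0` on the real line,
by its (everywhere convergent) power series `∑ (x/2)^(2m+k) / (m! (m+k)!)`. -/
def besselI (k : ℕ) (x : ℝ) : ℝ :=
  ∑' m : ℕ, (x / 2) ^ (2 * m + k) / ((m.factorial : ℝ) * ((m + k).factorial : ℝ))

/-- Directions of a step are indexed by `Fin 2`: `0` is "left", `1` is "right".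
The entry `V i j` is the probability that the next step has direction `i` when the previous step
had direction `j`; so a transition matrix has entries in `[0,1]` and columns summing to `1`. -/
def IsTransitionMatrix (V : Matrix (Fin 2) (Fin 2) ℝ) : Prop :=
  (∀ i j, 0 ≤ V i j ∧ V i j ≤ 1) ∧ ∀ j, V 0 j + V 1 j = 1

/-- The law of the next direction, given the previous direction `j`. -/
def nextDirection (V : Matrix (Fin 2) (Fin 2) ℝ) (hV : IsTransitionMatrix V) (j : Fin 2) :
    PMF (Fin 2) :=
  PMF.ofFintype (fun i => ENNReal.ofReal (V i j)) (by
    rw [Fin.sum_univ_two, ← ENNReal.ofReal_add (hV.1 0 j).1 (hV.1 1 j).1, hV.2 j,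
      ENNReal.ofReal_one])

/-- The displacement of a step: `-1` for left, `+1` for right. -/
def displacement : Fin 2 → ℤ := ![-1, 1]

/-- The law at time `k` of the pair (position, direction of the last step) of the correlated
random walk with transition matrix `V`. At time `0` the walk is at the origin with direction
distributed as `(1/2, 1/2)`; at each time step a new direction is drawn according to `V` from the
current one, and the walk moves one unit in the new direction. -/
def stateLaw (V : Matrix (Fin 2) (Fin 2) ℝ) (hV : IsTransitionMatrix V) : ℕ → PMF (ℤ × Fin 2)
  | 0 => (PMF.uniformOfFintype (Fin 2)).map fun j => (0, j)
  | k + 1 => (stateLaw V hV k).bind fun s =>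
      (nextDirection V hV s.2).map fun i => (s.1 + displacement i, i)

/-- The law of the position at time `k`. -/
def positionLaw (V : Matrix (Fin 2) (Fin 2) ℝ) (hV : IsTransitionMatrix V) (k : ℕ) : PMF ℤ :=
  (stateLaw V hV k).map Prod.fst

/-- The matrix `V^R_N` for final time `N`. -/
def VR (θ β : ℝ) (N : ℕ) : Matrix (Fin 2) (Fin 2) ℝ :=
  !![(θ / N) ^ β, 1 - (θ / N) ^ β; 1 - (θ / N) ^ β, (θ / N) ^ β]

open Classical in
/-- The return probability `p_N(0)` at the final time `N` of the walk whose `N` steps are all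
governed by `V^R_N`. For `θ, β > 0` and `N ≥ 1` the matrix `V^R_N` is a transition matrix exactly
when `θ ≤ N`; for the finitely many smaller `N` there is no walk, and the value is set to `0`. -/
def returnProbR (θ β : ℝ) (N : ℕ) : ℝ :=
  if hV : IsTransitionMatrix (VR θ β N) then (positionLaw (VR θ β N) hV N 0).toReal else 0

end

/-! ### One-step recursion for the point probabilities -/

noncomputable section

/-! Let `p` be the persistence probability and `q = 1 - p`. Cut a path with `a + 1` left and `b + 1`
right steps into runs. Each of the `a` gaps between left steps is a continuation (`p`) or a break
(`q`), likewise the `b` gaps on the right, and the two numbers of breaks agree or differ by one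
according to the first direction. This matching is the constant term of `(p + qz)^a (1 + 1/z) (p +
q/z)^b`, an integral over the unit circle (`stateLaw_eq_leftProb`). For `a = b = m`, with `z =
e^{it}`, `|p + qz|² = 1 - 2pq(1 - cos t)`, so `p_{2(m+1)}(0)` is `q` times the mean of `(1 + cos
t)(1 - u(1 - cos t))^m`, where `u = 2pq`.

With `n = m + 1`, `m u` is asymptotic to `2 (θ/2)^β n^{1-β}`. If `β < 1` it diverges and Laplace's
method applies (`tendsto_sqrt_mul_returnIntegral`); if `β = 1` it tends to `θ` and the limit
integral is a Bessel expression (`integral_one_add_cos_mul_exp`); if `β > 1` it vanishes and a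
first-order expansion suffices (`abs_returnIntegral_sub_le`). -/

theorem stateLaw_succ_apply (V : Matrix (Fin 2) (Fin 2) ℝ) (hV : IsTransitionMatrix V) (k : ℕ)
    (x : ℤ) (i : Fin 2) :
    (stateLaw V hV (k + 1) (x, i)).toReal =
      V i 0 * (stateLaw V hV k (x - displacement i, 0)).toReal +
      V i 1 * (stateLaw V hV k (x - displacement i, 1)).toReal := by
  have key : stateLaw V hV (k + 1) (x, i) =
      ∑ j : Fin 2, stateLaw V hV k (x - displacement i, j) * ENNReal.ofReal (V i j) := by
    rw [stateLaw, PMF.bind_apply, ENNReal.tsum_prod', ENNReal.tsum_comm, tsum_fintype]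
    refine Finset.sum_congr rfl fun j _ => ?_
    rw [tsum_eq_single (x - displacement i)]
    · congr 1
      rw [PMF.map_apply, tsum_eq_single i]
      · simp [nextDirection]
      · intro i' hi'
        simp [Prod.ext_iff, hi'.symm]
    · intro y hy
      rw [PMF.map_apply]
      convert mul_zero _
      refine ENNReal.tsum_eq_zero.2 fun i' => ?_
      rw [if_neg]
      rintro h
      simp only [Prod.mk.injEq] at h
      obtain ⟨h1, rfl⟩ := h
      exact hy (by rw [h1]; ring)
  rw [key, Fin.sum_univ_two, ENNReal.toReal_add, ENNReal.toReal_mul, ENNReal.toReal_mul,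
    ENNReal.toReal_ofReal (hV.1 i 0).1, ENNReal.toReal_ofReal (hV.1 i 1).1]
  · ring
  · exact ENNReal.mul_ne_top (PMF.apply_ne_top _ _) ENNReal.ofReal_ne_top
  · exact ENNReal.mul_ne_top (PMF.apply_ne_top _ _) ENNReal.ofReal_ne_top

theorem stateLaw_zero_apply (V : Matrix (Fin 2) (Fin 2) ℝ) (hV : IsTransitionMatrix V)
    (x : ℤ) (i : Fin 2) :
    (stateLaw V hV 0 (x, i)).toReal = if x = 0 then 1 / 2 else 0 := by
  rw [stateLaw, PMF.map_apply, tsum_fintype, Fin.sum_univ_two]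
  by_cases hx : x = 0
  · fin_cases i <;> simp [hx, PMF.uniformOfFintype_apply]
  · simp [hx]

theorem positionLaw_apply (V : Matrix (Fin 2) (Fin 2) ℝ) (hV : IsTransitionMatrix V) (k : ℕ)
    (x : ℤ) :
    (positionLaw V hV k x).toReal =
      (stateLaw V hV k (x, 0)).toReal + (stateLaw V hV k (x, 1)).toReal := by
  have key : positionLaw V hV k x = stateLaw V hV k (x, 0) + stateLaw V hV k (x, 1) := by
    rw [positionLaw, PMF.map_apply, ENNReal.tsum_prod', tsum_eq_single x]
    · rw [tsum_fintype, Fin.sum_univ_two]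
      simp
    · intro y hy
      simp [hy.symm]
  rw [key, ENNReal.toReal_add (PMF.apply_ne_top _ _) (PMF.apply_ne_top _ _)]

theorem stateLaw_eq_zero_of_lt_abs (V : Matrix (Fin 2) (Fin 2) ℝ) (hV : IsTransitionMatrix V)
    (k : ℕ) (x : ℤ) (i : Fin 2) (hx : (k : ℤ) < |x|) : (stateLaw V hV k (x, i)).toReal = 0 := by
  induction k generalizing x i with
  | zero =>
    rw [stateLaw_zero_apply, if_neg]
    rintro rfl
    simp at hx
  | succ k ih =>
    have h : (k : ℤ) < |x - displacement i| := by
      have hd : |displacement i| = 1 := by fin_cases i <;> simp [displacement]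
      have := abs_sub_abs_le_abs_sub x (displacement i)
      push_cast at hx
      omega
    rw [stateLaw_succ_apply, ih _ _ h, ih _ _ h]
    ring

/-! ### Exact law of the walk through circle pairings -/

/-- The pairing of `(p + q z) ^ a` with `(1 + z) (p + q z) ^ b` on the unit circle. -/
def runPairing (p q : ℝ) (a b : ℕ) : ℝ :=
  (2 * Real.pi)⁻¹ * ∫ t in -Real.pi..Real.pi,
    ((p + q * Complex.exp (t * Complex.I)) ^ a * (1 + Complex.exp (-(t * Complex.I))) *
      (p + q * Complex.exp (-(t * Complex.I))) ^ b).re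

theorem conj_exp_mul_I (t : ℝ) :
    (starRingEnd ℂ) (Complex.exp (t * Complex.I)) = Complex.exp (-(t * Complex.I)) := by
  rw [← Complex.exp_conj]
  simp

theorem conj_exp_neg_mul_I (t : ℝ) :
    (starRingEnd ℂ) (Complex.exp (-(t * Complex.I))) = Complex.exp (t * Complex.I) := by
  rw [← Complex.exp_conj]
  simp

/-- Conjugation turns the integrand into a polynomial in `z` without changing its real part; the
mean value property evaluates it at `0`. -/
theorem runPairing_zero_left (p q : ℝ) (b : ℕ) : runPairing p q 0 b = p ^ b := by
  have h1 : ∀ t : ℝ, ((p + q * Complex.exp (t * Complex.I)) ^ 0 *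
      (1 + Complex.exp (-(t * Complex.I))) *
      (p + q * Complex.exp (-(t * Complex.I))) ^ b).re =
      ((1 + circleMap 0 1 t) * (p + q * circleMap 0 1 t) ^ b).re := by
    intro t
    rw [← Complex.conj_re]
    simp [conj_exp_neg_mul_I, circleMap]
  have hd : Differentiable ℂ fun z : ℂ => (1 + z) * (p + q * z) ^ b := by fun_prop
  have h2 : Real.circleAverage (fun z : ℂ => (1 + z) * (p + q * z) ^ b) 0 1 = (p : ℂ) ^ b := by
    rw [hd.diffContOnCl.circleAverage]
    simp
  have hc : Continuous fun t : ℝ => (1 + circleMap 0 1 t) * (p + q * circleMap 0 1 t) ^ b := by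
    fun_prop
  have hper : Function.Periodic
      (fun t : ℝ => (1 + circleMap 0 1 t) * (p + q * circleMap 0 1 t) ^ b) (2 * Real.pi) := by
    intro t
    simp only [periodic_circleMap 0 1 t]
  have h3 := hper.intervalIntegral_add_eq (-Real.pi) 0
  rw [show -Real.pi + 2 * Real.pi = Real.pi by ring, zero_add] at h3
  rw [Real.circleAverage, ← h3] at h2
  rw [runPairing]
  simp_rw [h1]
  have h4 := Complex.reCLM.intervalIntegral_comp_comm
    (hc.intervalIntegrable (μ := MeasureTheory.volume) (-Real.pi) Real.pi)
  simp only [Complex.reCLM_apply] at h4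
  rw [h4]
  have h5 := congrArg Complex.re h2
  rw [Complex.smul_re, smul_eq_mul] at h5
  rw [h5, ← Complex.ofReal_pow, Complex.ofReal_re]

/-- On the circle `(p + qz)(1 + z⁻¹) = p(1 + z⁻¹) + q(1 + z)`. Conjugating the second term restores
`1 + z⁻¹` and swaps the exponents. -/
theorem runPairing_succ_left (p q : ℝ) (a b : ℕ) :
    runPairing p q (a + 1) b = p * runPairing p q a b + q * runPairing p q b a := by
  have hc : ∀ a b : ℕ, Continuous fun t : ℝ =>
      ((p + q * Complex.exp (t * Complex.I)) ^ a * (1 + Complex.exp (-(t * Complex.I))) *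
      (p + q * Complex.exp (-(t * Complex.I))) ^ b).re := by
    intro a b
    fun_prop
  simp only [runPairing]
  rw [mul_left_comm p, mul_left_comm q, ← mul_add, ← intervalIntegral.integral_const_mul p,
    ← intervalIntegral.integral_const_mul q, ← intervalIntegral.integral_add
      (((hc a b).intervalIntegrable _ _).const_mul p)
      (((hc b a).intervalIntegrable _ _).const_mul q)]
  congr 1
  refine intervalIntegral.integral_congr fun t _ => ?_
  rw [← Complex.conj_re ((p + q * Complex.exp (t * Complex.I)) ^ b * _ * _)]
  simp only [map_mul, map_add, map_pow, map_one, Complex.conj_ofReal, conj_exp_mul_I,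
    conj_exp_neg_mul_I]
  rw [← Complex.re_ofReal_mul, ← Complex.re_ofReal_mul, ← Complex.add_re]
  congr 1
  have hz : Complex.exp (t * Complex.I) * Complex.exp (-(t * Complex.I)) = 1 := by
    rw [← Complex.exp_add]
    simp
  linear_combination (q : ℂ) * (p + q * Complex.exp (t * Complex.I)) ^ a *
    (p + q * Complex.exp (-(t * Complex.I))) ^ b * hz

/-- The probability that a walk with persistence probability `p` and reversal probability `q` is
found after `l` left and `r` right steps, the last of them to the left. -/
def leftProb (p q : ℝ) : ℕ → ℕ → ℝ
  | 0, 0 => 1 / 2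
  | 0, _ + 1 => 0
  | l + 1, 0 => p ^ l / 2
  | a + 1, b + 1 => q / 2 * runPairing p q a b

theorem leftProb_succ {p q : ℝ} (h : p + q = 1) (l r : ℕ) :
    leftProb p q (l + 1) r = p * leftProb p q l r + q * leftProb p q r l := by
  rcases l with _ | l <;> rcases r with _ | r
  -- The recursion needs `p + q = 1` only here: the first step is fair whatever `p` is.
  · simp only [leftProb]
    linear_combination -(1 / 2 : ℝ) * h
  · simp only [leftProb, runPairing_zero_left]
    ring
  · simp only [leftProb]
    ring
  · simp only [leftProb, runPairing_succ_left]
    ring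

/-- By reflection symmetry the right-ending probability is `leftProb` with swapped arguments; each
half of the induction uses both halves of the hypothesis. -/
theorem stateLaw_eq_leftProb {p q : ℝ} (hV : IsTransitionMatrix !![p, q; q, p]) (l r : ℕ) :
    (stateLaw _ hV (l + r) ((r : ℤ) - l, 0)).toReal = leftProb p q l r ∧
    (stateLaw _ hV (l + r) ((r : ℤ) - l, 1)).toReal = leftProb p q r l := by
  have hpq : p + q = 1 := by simpa using hV.2 0
  obtain ⟨k, hk⟩ : ∃ k, l + r = k := ⟨_, rfl⟩
  induction k generalizing l r with
  | zero =>
    obtain ⟨rfl, rfl⟩ : l = 0 ∧ r = 0 := by omega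
    simp [stateLaw_zero_apply, leftProb]
  | succ k ih =>
    rw [hk]
    constructor
    · rw [stateLaw_succ_apply]
      rcases l with _ | l
      · obtain ⟨r, rfl⟩ : ∃ r', r = r' + 1 := ⟨k, by omega⟩
        -- With no left step taken, a last step to the left would have to start outside the range of
        -- the walk.
        have h : (k : ℤ) < |((r + 1 : ℕ) : ℤ) - (0 : ℕ) - displacement 0| := by
          rw [abs_of_nonneg] <;> simp [displacement] <;> omega
        rw [stateLaw_eq_zero_of_lt_abs _ _ _ _ _ h, stateLaw_eq_zero_of_lt_abs _ _ _ _ _ h]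
        simp [leftProb]
      · have hl : l + r = k := by omega
        have he : ((r : ℤ) - (l + 1 : ℕ) - displacement 0) = r - l := by
          simp [displacement]
          ring
        obtain ⟨h0, h1⟩ := ih l r hl
        rw [hl] at h0 h1
        rw [he, h0, h1, leftProb_succ hpq]
        simp
    · rw [stateLaw_succ_apply]
      rcases r with _ | r
      · obtain ⟨l, rfl⟩ : ∃ l', l = l' + 1 := ⟨k, by omega⟩
        have h : (k : ℤ) < |((0 : ℕ) : ℤ) - (l + 1 : ℕ) - displacement 1| := by
          rw [abs_of_nonpos] <;> simp [displacement] <;> omega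
        rw [stateLaw_eq_zero_of_lt_abs _ _ _ _ _ h, stateLaw_eq_zero_of_lt_abs _ _ _ _ _ h]
        simp [leftProb]
      · have hl : l + r = k := by omega
        have he : (((r + 1 : ℕ) : ℤ) - l - displacement 1) = r - l := by
          simp [displacement]
          ring
        obtain ⟨h0, h1⟩ := ih l r hl
        rw [hl] at h0 h1
        rw [he, h0, h1, leftProb_succ hpq]
        simp
        ring

/-! ### The return probability as a real integral -/

/-- The mean over the circle of `(1 + cos t) (1 - u (1 - cos t)) ^ m`. -/
def returnIntegral (m : ℕ) (u : ℝ) : ℝ :=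
  (2 * Real.pi)⁻¹ * ∫ t in -Real.pi..Real.pi, (1 + Real.cos t) * (1 - u * (1 - Real.cos t)) ^ m

theorem runPairing_self {p q : ℝ} (h : p + q = 1) (m : ℕ) :
    runPairing p q m m = returnIntegral m (2 * p * q) := by
  rw [runPairing, returnIntegral]
  congr 1
  refine intervalIntegral.integral_congr fun t _ => ?_
  have hz : Complex.exp (t * Complex.I) * Complex.exp (-(t * Complex.I)) = 1 := by
    rw [← Complex.exp_add]
    simp
  have hcos : Complex.exp (t * Complex.I) + Complex.exp (-(t * Complex.I)) =
      2 * (Real.cos t : ℂ) := by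
    rw [Complex.ofReal_cos, Complex.cos]
    ring_nf
  have hre : (1 + Complex.exp (-(t * Complex.I))).re = 1 + Real.cos t := by
    rw [← conj_exp_mul_I]
    simp [Complex.exp_ofReal_mul_I_re]
  have hmul : (p + q * Complex.exp (t * Complex.I)) * (p + q * Complex.exp (-(t * Complex.I))) =
      ((1 - 2 * p * q * (1 - Real.cos t) : ℝ) : ℂ) := by
    have h' : (p : ℂ) + q = 1 := by exact_mod_cast h
    push_cast
    push_cast at hcos
    linear_combination (q : ℂ) ^ 2 * hz + (p : ℂ) * q * hcos + (p + q + 1 : ℂ) * h'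
  rw [mul_right_comm, ← mul_pow, hmul, ← Complex.ofReal_pow, Complex.re_ofReal_mul, hre, mul_comm]

/-- The two final directions contribute equally, which absorbs the factor `1/2`; `m + 1` steps of
one kind have `m` gaps, hence the exponent. -/
theorem returnProbR_eq {θ β : ℝ} {m : ℕ} (hV : IsTransitionMatrix (VR θ β (2 * (m + 1)))) :
    returnProbR θ β (2 * (m + 1)) = (1 - (θ / (2 * (m + 1) : ℕ)) ^ β) *
      returnIntegral m (2 * (θ / (2 * (m + 1) : ℕ)) ^ β *
        (1 - (θ / (2 * (m + 1) : ℕ)) ^ β)) := by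
  rw [returnProbR, dif_pos hV, positionLaw_apply]
  obtain ⟨h0, h1⟩ := stateLaw_eq_leftProb hV (m + 1) (m + 1)
  rw [sub_self, ← two_mul] at h0 h1
  rw [← runPairing_self (add_sub_cancel _ _)]
  simp only [leftProb] at h0 h1
  simp only [VR] at *
  rw [h0, h1]
  ring

/-! ### Convergent `m u`: dominated convergence and Bessel functions -/

theorem mul_one_sub_cos_mem {u : ℝ} (h0 : 0 ≤ u) (h1 : u ≤ 1 / 2) (t : ℝ) :
    0 ≤ u * (1 - Real.cos t) ∧ u * (1 - Real.cos t) ≤ 1 := by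
  have hc := Real.cos_le_one t
  have hc' := Real.neg_one_le_cos t
  constructor
  · exact mul_nonneg h0 (by linarith)
  · nlinarith

theorem tendsto_returnIntegral {u : ℕ → ℝ} {c : ℝ} (hu : ∀ᶠ m in atTop, 0 ≤ u m ∧ u m ≤ 1 / 2)
    (hc : Tendsto (fun m : ℕ => m * u m) atTop (𝓝 c)) :
    Tendsto (fun m => returnIntegral m (u m)) atTop (𝓝 ((2 * Real.pi)⁻¹ *
      ∫ t in -Real.pi..Real.pi, (1 + Real.cos t) * Real.exp (-(c * (1 - Real.cos t))))) := by
  refine Tendsto.const_mul _ ?_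
  refine intervalIntegral.tendsto_integral_filter_of_dominated_convergence (fun _ => 2) ?_ ?_ ?_ ?_
  · refine Eventually.of_forall fun m => Continuous.aestronglyMeasurable ?_
    fun_prop
  · filter_upwards [hu] with m hm
    refine Eventually.of_forall fun t _ => ?_
    obtain ⟨h0, h1⟩ := mul_one_sub_cos_mem hm.1 hm.2 t
    rw [norm_mul, norm_pow, Real.norm_eq_abs, Real.norm_eq_abs]
    have hA : |1 + Real.cos t| ≤ 2 := by
      rw [abs_le]
      constructor <;> linarith [Real.cos_le_one t, Real.neg_one_le_cos t]
    have hB : |1 - u m * (1 - Real.cos t)| ^ m ≤ 1 := by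
      refine pow_le_one₀ (abs_nonneg _) ?_
      rw [abs_le]
      constructor <;> linarith
    calc _ ≤ 2 * (1 : ℝ) := mul_le_mul hA hB (by positivity) (by norm_num)
      _ = 2 := mul_one _
  · exact intervalIntegrable_const
  · refine Eventually.of_forall fun t _ => Tendsto.const_mul _ ?_
    have h := Real.tendsto_one_add_pow_exp_of_tendsto
      (g := fun m => -(u m * (1 - Real.cos t))) (t := -(c * (1 - Real.cos t))) (by
        convert (hc.mul_const (1 - Real.cos t)).neg using 2
        ring)
    simpa [sub_eq_add_neg] using h

/-- The mean of `cos ^ n` over the circle. -/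
def cosMoment (n : ℕ) : ℝ := (2 * Real.pi)⁻¹ * ∫ t in -Real.pi..Real.pi, Real.cos t ^ n

theorem cosMoment_zero : cosMoment 0 = 1 := by
  have := Real.pi_ne_zero
  simp only [cosMoment, pow_zero, intervalIntegral.integral_const, smul_eq_mul]
  field_simp
  ring

theorem cosMoment_one : cosMoment 1 = 0 := by
  simp [cosMoment]

theorem cosMoment_add_two (n : ℕ) : cosMoment (n + 2) = (n + 1) / (n + 2) * cosMoment n := by
  rw [cosMoment, cosMoment, integral_cos_pow]
  simp
  ring

theorem cosMoment_odd (m : ℕ) : cosMoment (2 * m + 1) = 0 := by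
  induction m with
  | zero => exact cosMoment_one
  | succ m ih => rw [show 2 * (m + 1) + 1 = 2 * m + 1 + 2 by ring, cosMoment_add_two, ih, mul_zero]

theorem cosMoment_even (m : ℕ) :
    cosMoment (2 * m) = ((2 * m).factorial : ℝ) / ((m.factorial : ℝ) ^ 2 * 4 ^ m) := by
  induction m with
  | zero => simp [cosMoment_zero]
  | succ m ih =>
    rw [show 2 * (m + 1) = 2 * m + 2 by ring, cosMoment_add_two, ih, Nat.factorial_succ,
      Nat.factorial_succ, Nat.factorial_succ]
    have := Nat.factorial_ne_zero m
    push_cast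
    field_simp
    ring

theorem one_add_cos_mul_pow_moment (n : ℕ) : (2 * Real.pi)⁻¹ * ∫ t in -Real.pi..Real.pi,
    (1 + Real.cos t) * Real.cos t ^ n = cosMoment n + cosMoment (n + 1) := by
  have hc : ∀ n : ℕ, IntervalIntegrable (fun t => Real.cos t ^ n) MeasureTheory.volume
      (-Real.pi) Real.pi := fun n => Continuous.intervalIntegrable (by fun_prop) _ _
  rw [cosMoment, cosMoment, ← mul_add, ← intervalIntegral.integral_add (hc n) (hc (n + 1))]
  congr 2
  ext t
  ring

theorem hasSum_one_add_cos_mul_exp (c : ℝ) :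
    HasSum (fun n : ℕ => c ^ n / n.factorial * (cosMoment n + cosMoment (n + 1)))
      ((2 * Real.pi)⁻¹ *
        ∫ t in -Real.pi..Real.pi, (1 + Real.cos t) * Real.exp (c * Real.cos t)) := by
  have h : HasSum (fun n : ℕ => ∫ t in -Real.pi..Real.pi,
      c ^ n / n.factorial * ((1 + Real.cos t) * Real.cos t ^ n))
      (∫ t in -Real.pi..Real.pi, (1 + Real.cos t) * Real.exp (c * Real.cos t)) := by
    refine intervalIntegral.hasSum_integral_of_dominated_convergence
      (fun n _ => 2 * (|c| ^ n / n.factorial)) ?_ ?_ ?_ ?_ ?_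
    · exact fun n => Continuous.aestronglyMeasurable (by fun_prop)
    · refine fun n => Eventually.of_forall fun t _ => ?_
      rw [norm_mul, norm_mul, norm_div, norm_pow, norm_pow, Real.norm_eq_abs, Real.norm_eq_abs,
        Real.norm_eq_abs, Real.norm_eq_abs, Nat.abs_cast, mul_comm]
      have hA : |1 + Real.cos t| ≤ 2 := by
        rw [abs_le]
        constructor <;> linarith [Real.cos_le_one t, Real.neg_one_le_cos t]
      have hB : |Real.cos t| ^ n ≤ 1 := pow_le_one₀ (abs_nonneg _) (Real.abs_cos_le_one t)
      refine mul_le_mul_of_nonneg_right ?_ (by positivity)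
      calc _ ≤ 2 * (1 : ℝ) := mul_le_mul hA hB (by positivity) (by norm_num)
        _ = 2 := mul_one _
    · exact Eventually.of_forall fun t _ => (Real.summable_pow_div_factorial |c|).mul_left 2
    · exact intervalIntegrable_const
    · refine Eventually.of_forall fun t _ => ?_
      have h := (NormedSpace.expSeries_div_hasSum_exp (c * Real.cos t)).mul_left (1 + Real.cos t)
      rw [← Real.exp_eq_exp_ℝ] at h
      have he : ∀ n : ℕ, (1 + Real.cos t) * ((c * Real.cos t) ^ n / n.factorial) =
          c ^ n / n.factorial * ((1 + Real.cos t) * Real.cos t ^ n) := fun n => by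
        rw [mul_pow]
        ring
      simpa only [he] using h
  simpa only [intervalIntegral.integral_const_mul, mul_left_comm, one_add_cos_mul_pow_moment]
    using h.mul_left (2 * Real.pi)⁻¹

/-- Odd cosine moments vanish, so in the expansion of `exp (c cos t)` the even powers of `c` sum to
`I₀` and the odd ones to `I₁`. -/
theorem integral_one_add_cos_mul_exp (c : ℝ) : (2 * Real.pi)⁻¹ *
    ∫ t in -Real.pi..Real.pi, (1 + Real.cos t) * Real.exp (-(c * (1 - Real.cos t))) =
    Real.exp (-c) * (besselI 0 c + besselI 1 c) := by
  have h := hasSum_one_add_cos_mul_exp c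
  set f := fun n : ℕ => c ^ n / n.factorial * (cosMoment n + cosMoment (n + 1)) with hf
  have he : ∀ m, f (2 * m) =
      (c / 2) ^ (2 * m + 0) / ((m.factorial : ℝ) * ((m + 0).factorial : ℝ)) := by
    intro m
    have := Nat.factorial_ne_zero m
    have := Nat.factorial_ne_zero (2 * m)
    simp only [hf, cosMoment_odd, cosMoment_even, add_zero]
    rw [div_pow, pow_mul 2 2 m]
    field_simp
    norm_num
  have ho : ∀ m, f (2 * m + 1) =
      (c / 2) ^ (2 * m + 1) / ((m.factorial : ℝ) * ((m + 1).factorial : ℝ)) := by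
    intro m
    have := Nat.factorial_ne_zero m
    have := Nat.factorial_ne_zero (2 * m)
    simp only [hf, cosMoment_odd, zero_add]
    rw [show 2 * m + 1 + 1 = 2 * m + 2 by ring, cosMoment_add_two, cosMoment_even,
      Nat.factorial_succ, Nat.factorial_succ, div_pow, pow_succ 2 (2 * m), pow_mul 2 2 m]
    push_cast
    field_simp
    norm_num
  have hse : Summable fun m => f (2 * m) :=
    h.summable.comp_injective (i := fun m : ℕ => 2 * m) fun a b hab => by simpa using hab
  have hso : Summable fun m => f (2 * m + 1) :=
    h.summable.comp_injective (i := fun m : ℕ => 2 * m + 1) fun a b hab => by simpa using hab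
  have hsum := h.unique (hse.hasSum.even_add_odd hso.hasSum)
  have hexp : ∀ t : ℝ, (1 + Real.cos t) * Real.exp (-(c * (1 - Real.cos t))) =
      Real.exp (-c) * ((1 + Real.cos t) * Real.exp (c * Real.cos t)) := by
    intro t
    rw [mul_left_comm, ← Real.exp_add]
    ring_nf
  simp_rw [hexp]
  rw [intervalIntegral.integral_const_mul, mul_left_comm, hsum, besselI, besselI]
  simp_rw [he, ho]

/-! ### Small `m u`: first-order expansion -/

/-- Below, Bernoulli's inequality; above, `1 - y ≤ e^{-y}` and `e^{-x} ≤ 1 - x + x²` for `x ≥ 0`. -/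
theorem abs_one_sub_pow_sub_le {y : ℝ} (h0 : 0 ≤ y) (h1 : y ≤ 1) (m : ℕ) :
    |(1 - y) ^ m - (1 - m * y)| ≤ (m * y) ^ 2 := by
  have hlow := one_add_mul_le_pow (a := -y) (by linarith) m
  have hup : (1 - y) ^ m ≤ Real.exp (-(m * y)) := by
    calc (1 - y) ^ m ≤ Real.exp (-y) ^ m :=
          pow_le_pow_left₀ (by linarith) (Real.one_sub_le_exp_neg y) m
      _ = Real.exp (-(m * y)) := by rw [← Real.exp_nat_mul]; ring_nf
  have hx : 0 ≤ m * y := by positivity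
  have hexp : Real.exp (-(m * y)) ≤ 1 - m * y + (m * y) ^ 2 := by
    rcases le_total (m * y) 1 with h | h
    · have := (abs_le.1 (Real.abs_exp_sub_one_sub_id_le (x := -(m * y))
        (by rwa [abs_neg, abs_of_nonneg hx]))).2
      linarith [neg_sq (m * y)]
    · have : Real.exp (-(m * y)) ≤ 1 := Real.exp_le_one_iff.2 (by linarith)
      nlinarith
  rw [← sub_eq_add_neg] at hlow
  rw [abs_le]
  constructor <;> nlinarith [sq_nonneg (m * y)]

/-- The slope `1/2` is the mean of `(1 + cos t)(1 - cos t)`. The constant is `8 = 2 · 2²`, from `1 +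
cos t ≤ 2` and `1 - cos t ≤ 2`. -/
theorem abs_returnIntegral_sub_le {u : ℝ} (h0 : 0 ≤ u) (h1 : u ≤ 1 / 2) (m : ℕ) :
    |returnIntegral m u - (1 - m * u / 2)| ≤ 8 * (m * u) ^ 2 := by
  have hpi := Real.pi_pos
  have hlin : (2 * Real.pi)⁻¹ * ∫ t in -Real.pi..Real.pi,
      (1 + Real.cos t) * (1 - m * (u * (1 - Real.cos t))) = 1 - m * u / 2 := by
    have hc : ∀ n : ℕ, IntervalIntegrable (fun t => (1 + Real.cos t) * Real.cos t ^ n)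
        MeasureTheory.volume (-Real.pi) Real.pi :=
      fun n => Continuous.intervalIntegrable (by fun_prop) _ _
    have he : ∀ t : ℝ, (1 + Real.cos t) * (1 - m * (u * (1 - Real.cos t))) =
        (1 - m * u) * ((1 + Real.cos t) * Real.cos t ^ 0) +
        m * u * ((1 + Real.cos t) * Real.cos t ^ 1) := by
      intro t
      ring
    simp_rw [he]
    rw [intervalIntegral.integral_add ((hc 0).const_mul _) ((hc 1).const_mul _),
      intervalIntegral.integral_const_mul, intervalIntegral.integral_const_mul, mul_add,
      mul_left_comm, mul_left_comm _ (m * u), one_add_cos_mul_pow_moment,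
      one_add_cos_mul_pow_moment, cosMoment_add_two, cosMoment_zero, cosMoment_one]
    norm_num
    ring
  have hi : ∀ f : ℝ → ℝ, Continuous f →
      IntervalIntegrable f MeasureTheory.volume (-Real.pi) Real.pi :=
    fun f hf => hf.intervalIntegrable _ _
  rw [← hlin, returnIntegral, ← mul_sub, ← intervalIntegral.integral_sub (hi _ (by fun_prop))
    (hi _ (by fun_prop)), abs_mul, abs_of_pos (by positivity)]
  have hb := intervalIntegral.norm_integral_le_of_norm_le_const (a := -Real.pi) (b := Real.pi)
    (f := fun t => (1 + Real.cos t) * (1 - u * (1 - Real.cos t)) ^ m -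
      (1 + Real.cos t) * (1 - m * (u * (1 - Real.cos t)))) (C := 8 * (m * u) ^ 2) (by
      intro t _
      obtain ⟨hy0, hy1⟩ := mul_one_sub_cos_mem h0 h1 t
      rw [← mul_sub, norm_mul, Real.norm_eq_abs, Real.norm_eq_abs]
      have hA : |1 + Real.cos t| ≤ 2 := by
        rw [abs_le]
        constructor <;> linarith [Real.cos_le_one t, Real.neg_one_le_cos t]
      have hB : m * (u * (1 - Real.cos t)) ≤ 2 * (m * u) := by
        have : 0 ≤ m * u := by positivity
        nlinarith [Real.neg_one_le_cos t]
      calc _ ≤ 2 * (m * (u * (1 - Real.cos t))) ^ 2 :=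
            mul_le_mul hA (abs_one_sub_pow_sub_le hy0 hy1 m) (abs_nonneg _) (by norm_num)
        _ ≤ 2 * (2 * (m * u)) ^ 2 := by gcongr
        _ = 8 * (m * u) ^ 2 := by ring)
  rw [Real.norm_eq_abs, sub_neg_eq_add, abs_of_pos (by linarith : 0 < Real.pi + Real.pi)] at hb
  calc _ ≤ (2 * Real.pi)⁻¹ * (8 * (m * u) ^ 2 * (Real.pi + Real.pi)) := by gcongr
    _ = _ := by field_simp; ring

/-! ### Large `m u`: Laplace's method -/

/-- By the half-angle formula the expression equals `x² sinc²(x / (2√s))`. -/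
theorem tendsto_mul_one_sub_cos_div_sqrt {s : ℕ → ℝ} (hs : Tendsto s atTop atTop) (x : ℝ) :
    Tendsto (fun m => 2 * s m * (1 - Real.cos (x / √(s m)))) atTop (𝓝 (x ^ 2)) := by
  have hy : Tendsto (fun m => x / √(s m) / 2) atTop (𝓝 0) := by
    have h := (Tendsto.const_div_atTop (Real.tendsto_sqrt_atTop.comp hs) x).div_const 2
    simpa using h
  have hsinc := ((Real.continuous_sinc.tendsto 0).comp hy).pow 2 |>.const_mul (x ^ 2)
  simp only [Real.sinc_zero, one_pow, mul_one] at hsinc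
  refine hsinc.congr' ?_
  filter_upwards [hs.eventually_gt_atTop 0] with m hm
  have hcos : Real.cos (x / √(s m)) = 1 - 2 * Real.sin (x / √(s m) / 2) ^ 2 := by
    rw [← Real.cos_sq_add_sin_sq (x / √(s m) / 2)]
    have := Real.cos_two_mul' (x / √(s m) / 2)
    rw [mul_div_cancel₀ _ two_ne_zero] at this
    linarith
  have hsq : √(s m) ^ 2 = s m := Real.sq_sqrt hm.le
  have hsq0 : √(s m) ≠ 0 := (Real.sqrt_pos.2 hm).ne'
  rw [hcos]
  rcases eq_or_ne x 0 with rfl | hx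
  · simp
  · simp only [Function.comp_apply]
    rw [Real.sinc_of_ne_zero (by positivity)]
    nth_rw 3 [← hsq]
    field_simp
    ring

/-- Put `s = m u / 2` and `t = x / √s`: the integrand tends to `2 e^{-x²}`, and `2√π / (2π) = 1/√π`.
-/
theorem tendsto_sqrt_mul_returnIntegral {u : ℕ → ℝ}
    (hu : ∀ᶠ m in atTop, 0 ≤ u m ∧ u m ≤ 1 / 2)
    (hs : Tendsto (fun m : ℕ => m * u m / 2) atTop atTop) :
    Tendsto (fun m : ℕ => √(m * u m / 2) * returnIntegral m (u m)) atTop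
      (𝓝 (1 / √Real.pi)) := by
  have hpi := Real.pi_pos
  set s : ℕ → ℝ := fun m => m * u m / 2 with hsdef
  let F : ℕ → ℝ → ℝ := fun m x => (1 + Real.cos x) * (1 - u m * (1 - Real.cos x)) ^ m
  let G : ℕ → ℝ → ℝ := fun m => Set.indicator (Set.Ioc (-Real.pi * √(s m)) (Real.pi * √(s m)))
    (fun x => F m (x / √(s m)))
  have hG : ∀ᶠ m in atTop,
      (2 * Real.pi)⁻¹ * ∫ x, G m x = √(s m) * returnIntegral m (u m) := by
    filter_upwards [hs.eventually_gt_atTop 0] with m hm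
    have hsq0 : 0 < √(s m) := Real.sqrt_pos.2 hm
    rw [MeasureTheory.integral_indicator measurableSet_Ioc, ← intervalIntegral.integral_of_le
      (by nlinarith), intervalIntegral.integral_comp_div _ hsq0.ne', smul_eq_mul,
      mul_div_cancel_right₀ _ hsq0.ne', mul_div_cancel_right₀ _ hsq0.ne', mul_left_comm]
    rfl
  have hlim : Tendsto (fun m => ∫ x, G m x) atTop (𝓝 (∫ x : ℝ, 2 * Real.exp (-1 * x ^ 2))) := by
    refine MeasureTheory.tendsto_integral_filter_of_dominated_convergence
      (fun x => 2 * Real.exp (-(4 / Real.pi ^ 2) * x ^ 2)) ?_ ?_ ?_ ?_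
    · refine Eventually.of_forall fun m => ?_
      refine (Continuous.aestronglyMeasurable ?_).indicator measurableSet_Ioc
      fun_prop
    · filter_upwards [hu, hs.eventually_gt_atTop 0] with m hm hm0
      refine Eventually.of_forall fun x => ?_
      have hsq0 : 0 < √(s m) := Real.sqrt_pos.2 hm0
      by_cases hx : x ∈ Set.Ioc (-Real.pi * √(s m)) (Real.pi * √(s m))
      · simp only [G, Set.indicator_of_mem hx, F]
        obtain ⟨hy0, hy1⟩ := mul_one_sub_cos_mem hm.1 hm.2 (x / √(s m))
        have hA : |1 + Real.cos (x / √(s m))| ≤ 2 := by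
          rw [abs_le]
          constructor <;>
            linarith [Real.cos_le_one (x / √(s m)), Real.neg_one_le_cos (x / √(s m))]
        have habs : |x / √(s m)| ≤ Real.pi := by
          rw [abs_le, le_div_iff₀ hsq0, div_le_iff₀ hsq0]
          exact ⟨hx.1.le, hx.2⟩
        -- The bound `1 - cos t ≥ 2t²/π²` holds on all of `[-π, π]`, so one Gaussian dominates the
        -- whole window and no separate tail estimate is needed.
        have hquad := Real.cos_le_one_sub_mul_cos_sq habs
        rw [div_pow, Real.sq_sqrt hm0.le] at hquad
        rw [norm_mul, norm_pow, Real.norm_eq_abs, Real.norm_eq_abs,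
          abs_of_nonneg (by linarith : 0 ≤ 1 - u m * (1 - Real.cos (x / √(s m))))]
        refine mul_le_mul hA ?_ (pow_nonneg (by linarith) _) (by norm_num)
        calc (1 - u m * (1 - Real.cos (x / √(s m)))) ^ m
            ≤ Real.exp (-(u m * (1 - Real.cos (x / √(s m))))) ^ m :=
              pow_le_pow_left₀ (by linarith) (Real.one_sub_le_exp_neg _) m
          _ = Real.exp (-(2 * s m * (1 - Real.cos (x / √(s m))))) := by
              rw [← Real.exp_nat_mul]
              simp only [hsdef]
              ring_nf
          _ ≤ Real.exp (-(4 / Real.pi ^ 2) * x ^ 2) := by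
              refine Real.exp_le_exp.2 ?_
              have h2 : 2 * s m * (2 / Real.pi ^ 2 * (x ^ 2 / s m)) =
                  4 / Real.pi ^ 2 * x ^ 2 := by
                have := hm0.ne'
                field_simp
                ring
              have h3 := mul_le_mul_of_nonneg_left
                (show 2 / Real.pi ^ 2 * (x ^ 2 / s m) ≤ 1 - Real.cos (x / √(s m)) by linarith)
                (show 0 ≤ 2 * s m by linarith)
              linarith
      · simp only [G, Set.indicator_of_notMem hx, norm_zero]
        positivity
    · exact (integrable_exp_neg_mul_sq (by positivity)).const_mul 2
    · refine Eventually.of_forall fun x => ?_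
      have hsqrt : Tendsto (fun m => √(s m)) atTop atTop := Real.tendsto_sqrt_atTop.comp hs
      have hy : Tendsto (fun m => x / √(s m)) atTop (𝓝 0) := Tendsto.const_div_atTop hsqrt x
      have hpow := Real.tendsto_one_add_pow_exp_of_tendsto
        (g := fun m => -(u m * (1 - Real.cos (x / √(s m))))) (t := -x ^ 2) (by
          refine (tendsto_mul_one_sub_cos_div_sqrt hs x).neg.congr fun m => ?_
          simp only [hsdef]
          ring)
      have hcos := ((Real.continuous_cos.tendsto 0).comp hy).const_add 1
      rw [Real.cos_zero, one_add_one_eq_two] at hcos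
      have h := hcos.mul hpow
      rw [← neg_one_mul] at h
      refine h.congr' ?_
      -- For fixed `x` the growing window eventually contains `x`.
      filter_upwards [hsqrt.eventually_gt_atTop (|x| / Real.pi)] with m hm
      rw [div_lt_iff₀ hpi, abs_lt] at hm
      have hx : x ∈ Set.Ioc (-Real.pi * √(s m)) (Real.pi * √(s m)) :=
        ⟨by linarith, by linarith⟩
      simp only [G, Set.indicator_of_mem hx, F, Function.comp_apply, sub_eq_add_neg]
  have h := (hlim.const_mul (2 * Real.pi)⁻¹).congr' hG
  convert h using 2
  rw [MeasureTheory.integral_const_mul, integral_gaussian, div_one]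
  have hsq : √Real.pi ^ 2 = Real.pi := Real.sq_sqrt hpi.le
  have hsq0 : √Real.pi ≠ 0 := (Real.sqrt_pos.2 hpi).ne'
  nth_rw 2 [← hsq]
  field_simp

/-! ### Scaling of the persistence probability -/

/-- The persistence probability for the final time `2 (m + 1)`. -/
def persistProb (θ β : ℝ) (m : ℕ) : ℝ := (θ / (2 * (m + 1) : ℕ)) ^ β

theorem persistProb_eq {θ : ℝ} (hθ : 0 < θ) (β : ℝ) (m : ℕ) :
    persistProb θ β m = (θ / 2) ^ β * ((m + 1 : ℕ) : ℝ) ^ (-β) := by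
  rw [persistProb, Nat.cast_mul, ← div_div, Nat.cast_ofNat, Real.div_rpow (by positivity)
    (by positivity), Real.rpow_neg (by positivity), div_eq_mul_inv]

theorem tendsto_natCast_succ : Tendsto (fun m : ℕ => ((m + 1 : ℕ) : ℝ)) atTop atTop :=
  tendsto_natCast_atTop_atTop.comp (tendsto_add_atTop_nat 1)

theorem tendsto_persistProb {θ β : ℝ} (hθ : 0 < θ) (hβ : 0 < β) :
    Tendsto (persistProb θ β) atTop (𝓝 0) := by
  have h := ((tendsto_rpow_neg_atTop hβ).comp tendsto_natCast_succ).const_mul ((θ / 2) ^ β)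
  rw [mul_zero] at h
  exact h.congr fun m => (persistProb_eq hθ β m).symm

theorem eventually_persistProb_mem {θ β : ℝ} (hθ : 0 < θ) (hβ : 0 < β) :
    ∀ᶠ m in atTop, 0 ≤ persistProb θ β m ∧ persistProb θ β m ≤ 1 := by
  filter_upwards [(tendsto_persistProb hθ hβ).eventually_le_const zero_lt_one] with m hm
  exact ⟨Real.rpow_nonneg (by positivity) _, hm⟩

/-- Since `p` tends to `0`, the matrix is eventually a transition matrix and the default value `0`
plays no role in the limits. -/
theorem eventually_returnProbR_eq {θ β : ℝ} (hθ : 0 < θ) (hβ : 0 < β) :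
    ∀ᶠ m in atTop, returnProbR θ β (2 * (m + 1)) = (1 - persistProb θ β m) *
      returnIntegral m (2 * persistProb θ β m * (1 - persistProb θ β m)) := by
  filter_upwards [eventually_persistProb_mem hθ hβ] with m hm
  refine returnProbR_eq ⟨fun i j => ?_, fun j => ?_⟩
  · simp only [persistProb] at hm
    simp only [VR]
    fin_cases i <;> fin_cases j <;> simp <;> simp at hm <;> constructor <;> linarith
  · fin_cases j <;> simp [VR]

/-- The factor of `m p (1 - p)` that tends to `1`. -/
def correction (θ β : ℝ) (m : ℕ) : ℝ := (m : ℝ) / (m + 1) * (1 - persistProb θ β m)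

theorem tendsto_correction {θ β : ℝ} (hθ : 0 < θ) (hβ : 0 < β) :
    Tendsto (correction θ β) atTop (𝓝 1) := by
  have h := (tendsto_natCast_div_add_atTop (1 : ℝ)).mul ((tendsto_persistProb hθ hβ).const_sub 1)
  rwa [sub_zero, mul_one] at h

/-- The sign of `1 - β` here decides the regime. -/
theorem mul_persistProb_eq {θ : ℝ} (hθ : 0 < θ) (β : ℝ) (m : ℕ) :
    m * (2 * persistProb θ β m * (1 - persistProb θ β m)) =
      2 * (correction θ β m * (θ / 2) ^ β * ((m + 1 : ℕ) : ℝ) ^ (1 - β)) := by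
  have h : ((m + 1 : ℕ) : ℝ) ^ (1 - β) = (m + 1 : ℕ) * ((m + 1 : ℕ) : ℝ) ^ (-β) := by
    rw [sub_eq_add_neg, Real.rpow_add (by positivity), Real.rpow_one]
  rw [h, correction]
  nth_rw 1 [persistProb_eq hθ]
  push_cast
  field_simp

theorem eventually_two_mul_persistProb_mem {θ β : ℝ} (hθ : 0 < θ) (hβ : 0 < β) :
    ∀ᶠ m in atTop, 0 ≤ 2 * persistProb θ β m * (1 - persistProb θ β m) ∧
      2 * persistProb θ β m * (1 - persistProb θ β m) ≤ 1 / 2 := by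
  filter_upwards [eventually_persistProb_mem hθ hβ] with m hm
  constructor
  · have := mul_nonneg hm.1 (sub_nonneg.2 hm.2)
    linarith
  · nlinarith [sq_nonneg (2 * persistProb θ β m - 1)]

/-! ### The three regimes -/

theorem tendsto_returnProbR_of_lt_one {θ β : ℝ} (hθ : 0 < θ) (hβ : 0 < β) (h1 : β < 1) :
    Tendsto (fun m : ℕ => ((m + 1 : ℕ) : ℝ) ^ ((1 - β) / 2) * returnProbR θ β (2 * (m + 1))) atTop
      (𝓝 (1 / √Real.pi * (2 / θ) ^ (β / 2))) := by
  have hK : 0 < (θ / 2) ^ β := by positivity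
  have hr := tendsto_correction hθ hβ
  have hrK := hr.mul_const ((θ / 2) ^ β)
  rw [one_mul] at hrK
  have hs : ∀ m : ℕ, m * (2 * persistProb θ β m * (1 - persistProb θ β m)) / 2 =
      correction θ β m * (θ / 2) ^ β * ((m + 1 : ℕ) : ℝ) ^ (1 - β) := by
    intro m
    rw [mul_persistProb_eq hθ, mul_div_cancel_left₀ _ two_ne_zero]
  have hpow : Tendsto (fun m : ℕ => ((m + 1 : ℕ) : ℝ) ^ (1 - β)) atTop atTop :=
    (tendsto_rpow_atTop (by linarith)).comp tendsto_natCast_succ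
  have hJ := tendsto_sqrt_mul_returnIntegral (eventually_two_mul_persistProb_mem hθ hβ)
    ((hrK.pos_mul_atTop hK hpow).congr fun m => (hs m).symm)
  have hfac : Tendsto (fun m => (1 - persistProb θ β m) / √(correction θ β m * (θ / 2) ^ β)) atTop
      (𝓝 (1 / √((θ / 2) ^ β))) := by
    have := ((tendsto_persistProb hθ hβ).const_sub 1).div hrK.sqrt (Real.sqrt_pos.2 hK).ne'
    rwa [sub_zero] at this
  have hval : 1 / √((θ / 2) ^ β) = (2 / θ) ^ (β / 2) := by
    rw [Real.sqrt_eq_rpow, ← Real.rpow_mul (by positivity), one_div, ← Real.inv_rpow (by positivity),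
      inv_div]
    ring_nf
  rw [hval] at hfac
  refine (hJ.mul hfac).congr' ?_
  filter_upwards [eventually_returnProbR_eq hθ hβ, hrK.eventually_const_lt hK] with m hm hm0
  have hsq : √(((m + 1 : ℕ) : ℝ) ^ (1 - β)) = ((m + 1 : ℕ) : ℝ) ^ ((1 - β) / 2) := by
    rw [Real.sqrt_eq_rpow, ← Real.rpow_mul (by positivity)]
    ring_nf
  have hne := (Real.sqrt_pos.2 hm0).ne'
  rw [hm, hs, Real.sqrt_mul hm0.le, hsq]
  field_simp

theorem tendsto_returnProbR_one {θ : ℝ} (hθ : 0 < θ) :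
    Tendsto (fun m : ℕ => returnProbR θ 1 (2 * (m + 1))) atTop
      (𝓝 (Real.exp (-θ) * (besselI 0 θ + besselI 1 θ))) := by
  have hc : Tendsto (fun m : ℕ => m * (2 * persistProb θ 1 m * (1 - persistProb θ 1 m))) atTop
      (𝓝 θ) := by
    have h := (tendsto_correction hθ zero_lt_one).mul_const θ
    rw [one_mul] at h
    refine h.congr fun m => ?_
    rw [mul_persistProb_eq hθ, sub_self, Real.rpow_zero, Real.rpow_one]
    ring
  have hJ := tendsto_returnIntegral (eventually_two_mul_persistProb_mem hθ zero_lt_one) hc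
  rw [integral_one_add_cos_mul_exp] at hJ
  have h := ((tendsto_persistProb hθ zero_lt_one).const_sub 1).mul hJ
  rw [sub_zero, one_mul] at h
  refine h.congr' ?_
  filter_upwards [eventually_returnProbR_eq hθ zero_lt_one] with m hm
  exact hm.symm

/-- With `J` the integral, `1 - qJ = p + q (m u / 2) - q (J - (1 - m u / 2))`. After scaling by
`n^{β-1}`, the first term is `O(1/n)`, the second gives the limit, and the last is `O(n^{1-β})`. -/
theorem tendsto_returnProbR_of_one_lt {θ β : ℝ} (hθ : 0 < θ) (h1 : 1 < β) :
    Tendsto (fun m : ℕ => ((m + 1 : ℕ) : ℝ) ^ (β - 1) * (1 - returnProbR θ β (2 * (m + 1)))) atTop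
      (𝓝 ((θ / 2) ^ β)) := by
  have hβ : 0 < β := by linarith
  have hp := tendsto_persistProb hθ hβ
  have hr := tendsto_correction hθ hβ
  have hdecay : Tendsto (fun m : ℕ => ((m + 1 : ℕ) : ℝ) ^ (1 - β)) atTop (𝓝 0) := by
    have h := (tendsto_rpow_neg_atTop (sub_pos.2 h1)).comp tendsto_natCast_succ
    rwa [neg_sub] at h
  have hcancel : ∀ m : ℕ, ((m + 1 : ℕ) : ℝ) ^ (β - 1) * ((m + 1 : ℕ) : ℝ) ^ (1 - β) = 1 := by
    intro m
    rw [← Real.rpow_add (by positivity)]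
    simp
  have hfirst : Tendsto (fun m : ℕ => ((m + 1 : ℕ) : ℝ) ^ (β - 1) * persistProb θ β m) atTop
      (𝓝 0) := by
    have h := (tendsto_inv_atTop_zero.comp tendsto_natCast_succ).const_mul ((θ / 2) ^ β)
    rw [mul_zero] at h
    refine h.congr fun m => ?_
    rw [persistProb_eq hθ, mul_left_comm, ← Real.rpow_add (by positivity), Function.comp_apply,
      ← Real.rpow_neg_one]
    ring_nf
  have hmain : Tendsto (fun m : ℕ => (1 - persistProb θ β m) * (correction θ β m * (θ / 2) ^ β))
      atTop (𝓝 ((θ / 2) ^ β)) := by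
    have h := (hp.const_sub 1).mul (hr.mul_const ((θ / 2) ^ β))
    rwa [sub_zero, one_mul, one_mul] at h
  set u : ℕ → ℝ := fun m => 2 * persistProb θ β m * (1 - persistProb θ β m) with hu
  have hmu : ∀ m : ℕ, m * u m = 2 * (correction θ β m * (θ / 2) ^ β *
      ((m + 1 : ℕ) : ℝ) ^ (1 - β)) := mul_persistProb_eq hθ β
  have herr : Tendsto (fun m : ℕ => ((m + 1 : ℕ) : ℝ) ^ (β - 1) * ((1 - persistProb θ β m) *
      (returnIntegral m (u m) - (1 - m * u m / 2)))) atTop (𝓝 0) := by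
    -- `32 = 8 · 2²`: the constant of the expansion times the squared factor `2` in `m u`.
    have hbound : Tendsto (fun m : ℕ => 32 * (correction θ β m * (θ / 2) ^ β) ^ 2 *
        ((m + 1 : ℕ) : ℝ) ^ (1 - β)) atTop (𝓝 0) := by
      have h := (((hr.mul_const ((θ / 2) ^ β)).pow 2).const_mul 32).mul hdecay
      rwa [mul_zero] at h
    refine squeeze_zero_norm' ?_ hbound
    filter_upwards [eventually_persistProb_mem hθ hβ, eventually_two_mul_persistProb_mem hθ hβ]
      with m hm hm'
    have hpos : 0 ≤ ((m + 1 : ℕ) : ℝ) ^ (β - 1) := by positivity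
    rw [norm_mul, norm_mul, Real.norm_eq_abs, Real.norm_eq_abs, Real.norm_eq_abs,
      abs_of_nonneg hpos, abs_of_nonneg (sub_nonneg.2 hm.2)]
    calc _ ≤ ((m + 1 : ℕ) : ℝ) ^ (β - 1) * (1 * (8 * (m * u m) ^ 2)) := by
          refine mul_le_mul_of_nonneg_left ?_ hpos
          exact mul_le_mul (by linarith) (abs_returnIntegral_sub_le hm'.1 hm'.2 m)
            (abs_nonneg _) zero_le_one
      _ = _ := by
          rw [hmu]
          linear_combination (32 * (correction θ β m * (θ / 2) ^ β) ^ 2 *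
            ((m + 1 : ℕ) : ℝ) ^ (1 - β)) * hcancel m
  have h := (hfirst.add hmain).sub herr
  rw [zero_add, sub_zero] at h
  refine h.congr' ?_
  filter_upwards [eventually_returnProbR_eq hθ hβ] with m hm
  rw [hm, hmu]
  linear_combination -((1 - persistProb θ β m) * (correction θ β m * (θ / 2) ^ β)) * hcancel m

end

theorem corollary3 (θ β : ℝ) (hθ : 0 < θ) (hβ : 0 < β) :
    (β < 1 →
      Tendsto (fun n : ℕ => (n : ℝ) ^ ((1 - β) / 2) * returnProbR θ β (2 * n)) atTop
        (𝓝 (1 / Real.sqrt Real.pi * (2 / θ) ^ (β / 2)))) ∧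
    (β = 1 →
      Tendsto (fun n : ℕ => returnProbR θ β (2 * n)) atTop
        (𝓝 (Real.exp (-θ) * (besselI 0 θ + besselI 1 θ)))) ∧
    (1 < β →
      Tendsto (fun n : ℕ => (n : ℝ) ^ (β - 1) * (1 - returnProbR θ β (2 * n))) atTop
        (𝓝 ((θ / 2) ^ β))) := by
  refine ⟨fun h => ?_, fun h => ?_, fun h => ?_⟩
  -- The closed form lives at `n = m + 1`; the shift leaves the limit unchanged.
  · exact (tendsto_add_atTop_iff_nat 1).1 (tendsto_returnProbR_of_lt_one hθ hβ h)
  · subst h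
    exact (tendsto_add_atTop_iff_nat 1).1 (tendsto_returnProbR_one hθ)
  · exact (tendsto_add_atTop_iff_nat 1).1 (tendsto_returnProbR_of_one_lt hθ h)
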